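/- Let $n,m\ge 1$, let $1<p_1,\dots,p_m<\infty$, $\frac1p=\frac1{p_1}+\cdots+\frac1{p_m}$ and $0<p\le q<\infty$. Let $\mathscr B$ be a basis in $\mathbb R^n$, i.e. a collection of nonempty open sets of finite Lebesgue measure, and let $\varphi:(0,\infty)\to(0,\infty)$ be essentially non-decreasing (there is a constant $c$ with $\varphi(s)\le c\,\varphi(t)$ whenever $0<s\le t$) with $\lim_{t\to\infty}\varphi(t)/t=0$. Let $Y_1,\dots,Y_m$ be Banach function spaces over $\mathbb R^n$ with Lebesgue measure, i.e. each is given by a Banach function norm (a norm on nonnegative measurable functions modulo a.e. equality, with values in $[0,\infty]$, which is monotone, has the Fatou property, is finite on indicators of sets of finite measure, and satisfies $\int_E f\le C_E\|f\|_{Y_i}$ for every set $E$ of finite measure). Let $Y_i'$ be the associate space, $\|g\|_{Y_i'}=\sup\{\int_{\mathbb R^n}|fg|\,dx:\|f\|_{Y_i}\le1\}$. For $X=Y_i$ or $X=Y_i'$ and $B\in\mathscr B$ put $\|g\|_{X,B}=\|\tau_{|B|^{1/n}}(g\mathbf 1_B)\|_X$, where $\tau_\delta h(x)=h(\delta x)$.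 Define $$M_{\mathscr B}f(x)=\sup_{B\in\mathscr B,\,B\ni x}\frac1{|B|}\int_B|f|\,dy,\qquad \mathcal M_{\vec Y'}(\vec f)(x)=\sup_{B\in\mathscr B,\,B\ni x}\prod_{i=1}^m\|f_i\|_{Y_i',B},$$ $$\mathcal M_{\mathscr B,\varphi}(\vec f)(x)=\sup_{B\in\mathscr B,\,B\ni x}\varphi(|B|)\prod_{i=1}^m\frac1{|B|}\int_B|f_i|\,dy,$$ a supremum over no sets being $0$. Assume that $$\mathcal M_{\vec Y'}:L^{p_1}(\mathbb R^n)\times\cdots\times L^{p_m}(\mathbb R^n)\to L^p(\mathbb R^n)$$ is bounded. Let $w_1,\dots,w_m,v:\mathbb R^n\to[0,\infty)$ be measurable, and suppose that for some $\gamma\in(0,1)$ the measure $v^q\,dx$ satisfies the Tauberian condition with respect to $\mathscr B$ and $\gamma$: there is a finite constant $C$ such that for all measurable $E\subset\mathbb R^n$ $$v^q\big(\{x\in\mathbb R^n: M_{\mathscr B}(\mathbf 1_E)(x)>\gamma\}\big)\le C\,v^q(E),\qquad v^q(E):=\int_E v^q\,dx .$$ If moreover (with $0^{-1}=\infty$ and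 $0\cdot\infty=0$) $$\sup_{B\in\mathscr B}\varphi(|B|)\,|B|^{\frac1q-\frac1p}\Big(\frac1{|B|}\int_B v^q\,dx\Big)^{\frac1q}\prod_{i=1}^m\big\|w_i^{-1}\big\|_{Y_i,B}<\infty,$$ then $\mathcal M_{\mathscr B,\varphi}$ is bounded from $L^{p_1}(w_1^{p_1})\times\cdots\times L^{p_m}(w_m^{p_m})$ to $L^q(v^q)$: there is a finite constant $C'$ such that $\|\mathcal M_{\mathscr B,\varphi}(\vec f)\|_{L^q(v^q)}\le C'\prod_{i=1}^m\|f_i\|_{L^{p_i}(w_i^{p_i})}$ for all $f_i\in L^{p_i}(w_i^{p_i})$. -/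

import Mathlib

open MeasureTheory Filter Topology
open scoped ENNReal NNReal

noncomputable section

namespace BasisMaximal

/-- A basis in `ℝⁿ`: a collection of open sets. As averages over its members are taken, the members
are nonempty and of finite Lebesgue measure. -/
structure IsBasis {n : ℕ} (𝓑 : Set (Set (EuclideanSpace ℝ (Fin n)))) : Prop where
  isOpen : ∀ B ∈ 𝓑, IsOpen B
  nonempty : ∀ B ∈ 𝓑, B.Nonempty
  volume_lt_top : ∀ B ∈ 𝓑, volume B < ∞

/-- A Banach function space over `ℝⁿ` with Lebesgue measure, given by its Banach function norm on
the nonnegative Lebesgue measurable functions (the space consists of the measurable functions `f`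
for which the norm of `|f|` is finite). -/
structure BanachFunctionSpace (n : ℕ) where
  /-- the function norm -/
  norm : (EuclideanSpace ℝ (Fin n) → ℝ≥0∞) → ℝ≥0∞
  norm_eq_zero_iff : ∀ f, AEMeasurable f volume → (norm f = 0 ↔ f =ᵐ[volume] 0)
  norm_smul : ∀ (c : ℝ≥0) (f), AEMeasurable f volume → norm (fun x => c * f x) = c * norm f
  norm_add_le : ∀ f g, AEMeasurable f volume → AEMeasurable g volume →
    norm (fun x => f x + g x) ≤ norm f + norm g
  /-- lattice property -/
  norm_mono : ∀ f g, AEMeasurable f volume → AEMeasurable g volume →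
    f ≤ᵐ[volume] g → norm f ≤ norm g
  /-- Fatou property -/
  norm_iSup : ∀ f : ℕ → EuclideanSpace ℝ (Fin n) → ℝ≥0∞, (∀ k, AEMeasurable (f k) volume) →
    (∀ᵐ x, Monotone fun k => f k x) → norm (fun x => ⨆ k, f k x) = ⨆ k, norm (f k)
  norm_indicator_lt_top : ∀ s, MeasurableSet s → volume s < ∞ →
    norm (s.indicator fun _ => 1) < ∞
  lintegral_le : ∀ s, MeasurableSet s → volume s < ∞ →
    ∃ C : ℝ≥0, ∀ f, AEMeasurable f volume → ∫⁻ x in s, f x ≤ C * norm f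

/-- The norm of the associate space `Y'`:
`‖g‖_{Y'} = sup {∫ f g : f ≥ 0 measurable, ‖f‖_Y ≤ 1}`. -/
def BanachFunctionSpace.associateNorm {n : ℕ} (Y : BanachFunctionSpace n)
    (g : EuclideanSpace ℝ (Fin n) → ℝ≥0∞) : ℝ≥0∞ :=
  ⨆ (f : EuclideanSpace ℝ (Fin n) → ℝ≥0∞) (_ : AEMeasurable f volume) (_ : Y.norm f ≤ 1),
    ∫⁻ x, f x * g x

/-- The average `‖g‖_{X,B} = ‖τ_δ (g 1_B)‖_X` of `g` over `B` with respect to a function norm on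
`ℝⁿ`, where `τ_δ h (x) = h (δ x)` and `δ = |B|^{1/n}`; so `τ_δ (1_B)` is the indicator of a set of
measure one. -/
def localNorm {n : ℕ} (N : (EuclideanSpace ℝ (Fin n) → ℝ≥0∞) → ℝ≥0∞)
    (B : Set (EuclideanSpace ℝ (Fin n))) (g : EuclideanSpace ℝ (Fin n) → ℝ≥0∞) : ℝ≥0∞ :=
  N fun x => B.indicator g (((volume B).toReal ^ (1 / (n : ℝ))) • x)

/-- `M_𝓑 f (x) = sup_{B ∋ x} |B|⁻¹ ∫_B |f|`. -/
def maximal {n : ℕ} (𝓑 : Set (Set (EuclideanSpace ℝ (Fin n))))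
    (f : EuclideanSpace ℝ (Fin n) → ℝ) (x : EuclideanSpace ℝ (Fin n)) : ℝ≥0∞ :=
  ⨆ B ∈ 𝓑, ⨆ _ : x ∈ B, ⨍⁻ y in B, ‖f y‖ₑ ∂volume

/-- `M_{𝓑,φ} f (x) = sup_{B ∋ x} φ(|B|) ∏ᵢ |B|⁻¹ ∫_B |fᵢ|`. -/
def fractionalMaximal {n m : ℕ} (𝓑 : Set (Set (EuclideanSpace ℝ (Fin n)))) (φ : ℝ → ℝ)
    (f : Fin m → EuclideanSpace ℝ (Fin n) → ℝ) (x : EuclideanSpace ℝ (Fin n)) : ℝ≥0∞ :=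
  ⨆ B ∈ 𝓑, ⨆ _ : x ∈ B,
    ENNReal.ofReal (φ (volume B).toReal) * ∏ i, ⨍⁻ y in B, ‖f i y‖ₑ ∂volume

/-- `M_{Y'} f (x) = sup_{B ∋ x} ∏ᵢ ‖fᵢ‖_{Yᵢ',B}`. -/
def associateMaximal {n m : ℕ} (𝓑 : Set (Set (EuclideanSpace ℝ (Fin n))))
    (Y : Fin m → BanachFunctionSpace n)
    (f : Fin m → EuclideanSpace ℝ (Fin n) → ℝ) (x : EuclideanSpace ℝ (Fin n)) : ℝ≥0∞ :=
  ⨆ B ∈ 𝓑, ⨆ _ : x ∈ B, ∏ i, localNorm (Y i).associateNorm B fun y => ‖f i y‖ₑ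

/-- The measure `u^s dx`. -/
def powMeasure {n : ℕ} (u : EuclideanSpace ℝ (Fin n) → ℝ≥0) (s : ℝ) :
    Measure (EuclideanSpace ℝ (Fin n)) :=
  volume.withDensity fun x => (u x : ℝ≥0∞) ^ s

/-- The Tauberian condition for the basis `𝓑`, the level `γ` and the measure `μ`. -/
def Tauberian {n : ℕ} (𝓑 : Set (Set (EuclideanSpace ℝ (Fin n)))) (γ : ℝ)
    (μ : Measure (EuclideanSpace ℝ (Fin n))) : Prop :=
  ∃ C : ℝ≥0, ∀ E : Set (EuclideanSpace ℝ (Fin n)), MeasurableSet E →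
    μ {x | ENNReal.ofReal γ < maximal 𝓑 (E.indicator fun _ => 1) x} ≤ C * μ E

/-- `T` is bounded from `L^{p₁}(μ₁) × ⋯ × L^{pₘ}(μₘ)` to `L^q(ν)`. -/
def BoundedOn {n m : ℕ}
    (T : (Fin m → EuclideanSpace ℝ (Fin n) → ℝ) → EuclideanSpace ℝ (Fin n) → ℝ≥0∞)
    (P : Fin m → ℝ) (μ : Fin m → Measure (EuclideanSpace ℝ (Fin n)))
    (q : ℝ) (ν : Measure (EuclideanSpace ℝ (Fin n))) : Prop :=
  ∃ C : ℝ≥0, ∀ f : Fin m → EuclideanSpace ℝ (Fin n) → ℝ,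
    (∀ i, MemLp (f i) (ENNReal.ofReal (P i)) (μ i)) →
      MemLp (T f) (ENNReal.ofReal q) ν ∧
      eLpNorm (T f) (ENNReal.ofReal q) ν ≤
        C * ∏ i, eLpNorm (f i) (ENNReal.ofReal (P i)) (μ i)

end BasisMaximal

end

/-! ### Greedy selection and the Tauberian condition -/

namespace BasisMaximal

/-! The `q`-th power of the maximal function is `sup_{B ∋ x} d_B`, with `d_B` the `q`-th power of
`φ(|B|) ∏ᵢ |B|⁻¹ ∫_B |fᵢ|`. From finitely many `B`, taken in order of decreasing `d`, keep those of
which at most the fraction `γ` is covered by the sets already kept (`exists_greedy_selection`). The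
kept sets `A` have disjoint pieces `E A` with `|E A| ≥ (1 - γ)|A|`. Every `B` is covered beyond the
fraction `γ` by kept sets of no smaller value, so the Tauberian condition compares the distribution
functions of the full and the kept supremum. Thus the integral is controlled by `∑ d_A ν(A)` over
kept sets, where `ν = v^q dx` (`lintegral_iSup_le_of_tauberian`).

For a single `A`, Hölder for the pair `Yᵢ, Yᵢ'` and the bump condition give `d_A ν(A) ≤ K^q (G_A^p
|A|)^{q/p}` with `G_A = ∏ᵢ ‖fᵢ wᵢ‖_{Yᵢ',A}` (`rpow_mul_powMeasure_le`). Since `q/p ≥ 1`, the sum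
moves inside the power. As `G_A` is at most the associate maximal function of `(fᵢ wᵢ)` on `E A`,
disjointness bounds `∑ G_A^p |A|` by `(1 - γ)⁻¹` times the integral of its `p`-th power, and the
assumed `L^p` bound finishes. -/

/-- Pointwise comparison of distribution functions implies comparison of integrals. -/
theorem lintegral_le_of_measure_lt_le {α : Type*} [MeasurableSpace α] {ν : Measure α} [SFinite ν]
    {F H : α → ℝ≥0∞} (hF : Measurable F) (hH : Measurable H) (C : ℝ≥0)
    (h : ∀ t : ℝ≥0∞, ν {x | t < F x} ≤ C * ν {x | t < H x}) :
    ∫⁻ x, F x ∂ν ≤ C * ∫⁻ x, H x ∂ν := by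
  -- Layer cake by Tonelli on the region under the graph; values `∞` are allowed.
  have key : ∀ G : α → ℝ≥0∞, Measurable G →
      ∫⁻ x, G x ∂ν = ∫⁻ t in Set.Ioi (0 : ℝ), ν {x | ENNReal.ofReal t < G x} := by
    intro G hG
    have hms : MeasurableSet {z : α × ℝ | ENNReal.ofReal z.2 < G z.1} :=
      measurableSet_lt (ENNReal.measurable_ofReal.comp measurable_snd) (hG.comp measurable_fst)
    have hslice : ∀ a : ℝ≥0∞,
        ∫⁻ t in Set.Ioi (0 : ℝ), {t : ℝ | ENNReal.ofReal t < a}.indicator 1 t = a := by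
      intro a
      rw [lintegral_indicator_one (measurableSet_lt ENNReal.measurable_ofReal measurable_const),
        Measure.restrict_apply (measurableSet_lt ENNReal.measurable_ofReal measurable_const)]
      rcases eq_or_ne a ∞ with rfl | ha
      · simp [ENNReal.ofReal_lt_top]
      · have : {t : ℝ | ENNReal.ofReal t < a} ∩ Set.Ioi 0 = Set.Ioo 0 a.toReal := by
          ext t
          simp only [Set.mem_inter_iff, Set.mem_ofPred_eq, Set.mem_Ioi, Set.mem_Ioo]
          constructor
          · rintro ⟨h1, h2⟩
            exact ⟨h2, (ENNReal.ofReal_lt_iff_lt_toReal h2.le ha).1 h1⟩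
          · rintro ⟨h2, h1⟩
            exact ⟨(ENNReal.ofReal_lt_iff_lt_toReal h2.le ha).2 h1, h2⟩
        rw [this, Real.volume_Ioo, sub_zero, ENNReal.ofReal_toReal ha]
    calc ∫⁻ x, G x ∂ν
        = ∫⁻ x, (∫⁻ t in Set.Ioi (0 : ℝ),
            {z : α × ℝ | ENNReal.ofReal z.2 < G z.1}.indicator 1 (x, t)) ∂ν := by
          refine lintegral_congr fun x => ?_
          exact (hslice (G x)).symm
      _ = ∫⁻ t in Set.Ioi (0 : ℝ), (∫⁻ x,
            {z : α × ℝ | ENNReal.ofReal z.2 < G z.1}.indicator 1 (x, t) ∂ν) :=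
          lintegral_lintegral_swap (measurable_one.indicator hms).aemeasurable
      _ = _ := by
          refine lintegral_congr fun t => ?_
          exact lintegral_indicator_one (s := {x | ENNReal.ofReal t < G x})
            (measurableSet_lt measurable_const hG)
  rw [key F hF, key H hH, ← lintegral_const_mul' _ _ ENNReal.coe_ne_top]
  exact lintegral_mono fun t => h _

/-- Greedy selection from a finite family of sets, in the order of decreasing values of `d`: the
selected sets have large disjoint pieces, and each set of the family has a large intersection with
the union of the selected sets of no smaller value. -/
theorem exists_greedy_selection {α : Type*} [MeasurableSpace α] {μ : Measure α} {θ : ℝ}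
    (hθ₀ : 0 < θ) (hθ₁ : θ < 1) (d : Set α → ℝ≥0∞) (s : Finset (Set α))
    (hmeas : ∀ B ∈ s, MeasurableSet B) (hpos : ∀ B ∈ s, μ B ≠ 0) (hfin : ∀ B ∈ s, μ B ≠ ∞) :
    ∃ T ⊆ s, ∃ E : Set α → Set α, (∀ A ∈ T, E A ⊆ A ∧ MeasurableSet (E A) ∧
        ENNReal.ofReal (1 - θ) * μ A ≤ μ (E A)) ∧ (T : Set (Set α)).PairwiseDisjoint E ∧
      ∀ B ∈ s, ENNReal.ofReal θ * μ B < μ (B ∩ ⋃ A ∈ T, ⋃ _ : d B ≤ d A, A) := by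
  classical
  -- The set inserted last has the smallest value, so every set already selected is admissible for
  -- covering it.
  induction s using Finset.induction_on_min_value d with
  | empty => exact ⟨∅, by simp, id, by simp, by simp, by simp⟩
  | insert a s ha hmin ih =>
    obtain ⟨T, hTs, E, hE, hdisj, hcov⟩ := ih (fun B hB => hmeas B (by simp [hB]))
      (fun B hB => hpos B (by simp [hB])) (fun B hB => hfin B (by simp [hB]))
    have hma := hmeas a (by simp)
    have hfa := hfin a (by simp)
    have hpa := hpos a (by simp)
    have hUeq : (⋃ A ∈ T, ⋃ _ : d a ≤ d A, A) = ⋃ A ∈ T, A :=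
      Set.iUnion₂_congr fun A hA => by simp [hmin A (hTs hA)]
    have hUm : MeasurableSet (⋃ A ∈ T, A) :=
      Finset.measurableSet_biUnion _ fun A hA => hmeas A (by simp [hTs hA])
    by_cases hbig : ENNReal.ofReal θ * μ a < μ (a ∩ ⋃ A ∈ T, A)
    · refine ⟨T, hTs.trans (Finset.subset_insert _ _), E, hE, hdisj, fun B hB => ?_⟩
      rcases Finset.mem_insert.1 hB with rfl | hB
      · rwa [hUeq]
      · exact hcov B hB
    · have haT : a ∉ T := fun h => ha (hTs h)
      have hne : ∀ A ∈ T, A ≠ a := fun A hA h => haT (h ▸ hA)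
      refine ⟨insert a T, Finset.insert_subset_insert _ hTs,
        Function.update E a (a \ ⋃ A ∈ T, A), ?_, ?_, ?_⟩
      · intro A hA
        rcases Finset.mem_insert.1 hA with rfl | hA
        · rw [Function.update_self]
          refine ⟨Set.sdiff_subset, hma.diff hUm, ?_⟩
          rw [not_lt] at hbig
          rw [← Set.sdiff_inter_self_eq_sdiff, Set.inter_comm,
            measure_sdiff Set.inter_subset_left (hma.inter hUm).nullMeasurableSet
              (measure_ne_top_of_subset Set.inter_subset_left hfa),
            ENNReal.ofReal_sub _ hθ₀.le, ENNReal.ofReal_one,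
            ENNReal.sub_mul fun _ _ => hfa, one_mul]
          exact tsub_le_tsub_left hbig _
        · rw [Function.update_of_ne (hne A hA)]
          exact hE A hA
      · rw [Finset.coe_insert]
        refine Set.PairwiseDisjoint.insert_of_notMem ?_ (by simpa using haT) ?_
        · intro A hA A' hA' hAA'
          simp only [Function.onFun]
          rw [Function.update_of_ne (hne A hA), Function.update_of_ne (hne A' hA')]
          exact hdisj hA hA' hAA'
        · intro A hA
          rw [Function.update_self, Function.update_of_ne (hne A hA)]
          exact Set.disjoint_left.2 fun x hx hx' =>
            hx.2 (Set.mem_biUnion (show A ∈ (T : Set (Set α)) from hA) ((hE A hA).1 hx'))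
      · intro B hB
        rcases Finset.mem_insert.1 hB with rfl | hB
        · have : B ∩ ⋃ A ∈ insert B T, ⋃ _ : d B ≤ d A, A = B :=
            Set.inter_eq_left.2 fun x hx => by
              simp only [Set.mem_iUnion]
              exact ⟨B, by simp, le_rfl, hx⟩
          rw [this]
          calc ENNReal.ofReal θ * μ B < 1 * μ B := by
                refine (ENNReal.mul_lt_mul_iff_left hpa hfa).2 ?_
                simpa using (ENNReal.ofReal_lt_one).2 hθ₁
            _ = μ B := one_mul _
        · refine (hcov B hB).trans_le (measure_mono (Set.inter_subset_inter_right _ ?_))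
          exact Set.biUnion_subset_biUnion_left fun A hA => by simp [show A ∈ T from hA]

/-- Superlevel sets are unions of members, hence open; this gives measurability even for uncountable
families. -/
theorem lowerSemicontinuous_iSup_mem {X : Type*} [TopologicalSpace X] {S : Set (Set X)}
    (hS : ∀ B ∈ S, IsOpen B) (d : Set X → ℝ≥0∞) :
    LowerSemicontinuous fun x => ⨆ B ∈ S, ⨆ _ : x ∈ B, d B := by
  refine lowerSemicontinuous_iff_isOpen_preimage.2 fun t => ?_
  have : (fun x => ⨆ B ∈ S, ⨆ _ : x ∈ B, d B) ⁻¹' Set.Ioi t = ⋃ B ∈ S, ⋃ _ : t < d B, B := by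
    ext x
    simp only [Set.mem_preimage, Set.mem_Ioi, lt_iSup_iff, Set.mem_iUnion, exists_prop]
    tauto
  rw [this]
  exact isOpen_biUnion fun B hB => isOpen_iUnion fun _ => hS B hB

/-- Lindelöf, applied to the superlevel set of each level in a countable dense set. -/
theorem exists_countable_iSup_mem_eq {X : Type*} [TopologicalSpace X] [SecondCountableTopology X]
    {S : Set (Set X)} (hS : ∀ B ∈ S, IsOpen B) (d : Set X → ℝ≥0∞) :
    ∃ S' ⊆ S, S'.Countable ∧
      ∀ x, ⨆ B ∈ S, ⨆ _ : x ∈ B, d B = ⨆ B ∈ S', ⨆ _ : x ∈ B, d B := by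
  obtain ⟨D, hDc, hDd⟩ := TopologicalSpace.exists_countable_dense ℝ≥0∞
  have := fun t : ℝ≥0∞ => TopologicalSpace.isOpen_biUnion_countable {B ∈ S | t < d B} id
    fun B hB => hS B hB.1
  choose A hAS hAc hAU using this
  refine ⟨⋃ t ∈ D, A t, Set.iUnion₂_subset fun t _ => (hAS t).trans fun B hB => hB.1,
    hDc.biUnion fun t _ => hAc t, fun x => le_antisymm ?_ ?_⟩
  · refine le_of_forall_lt fun t ht => ?_
    obtain ⟨r, hrD, htr, hr⟩ := hDd.exists_between ht
    simp only [lt_iSup_iff] at hr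
    obtain ⟨B, hB, hxB, hrB⟩ := hr
    have hx : x ∈ ⋃ B ∈ A r, id B := by
      rw [hAU r]
      exact Set.mem_biUnion (show B ∈ {B ∈ S | r < d B} from ⟨hB, hrB⟩) hxB
    obtain ⟨B', hB', hxB'⟩ := Set.mem_iUnion₂.1 hx
    simp only [lt_iSup_iff]
    exact ⟨B', Set.mem_biUnion hrD hB', hxB', htr.trans (hAS r hB').2⟩
  · refine iSup₂_le fun B hB => ?_
    obtain ⟨t, -, hBt⟩ := Set.mem_iUnion₂.1 hB
    exact le_iSup₂_of_le B (hAS t hBt).1 le_rfl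

variable {n : ℕ} {𝓑 : Set (Set (EuclideanSpace ℝ (Fin n)))}

theorem IsBasis.volume_ne_zero (h𝓑 : IsBasis 𝓑) {B : Set (EuclideanSpace ℝ (Fin n))}
    (hB : B ∈ 𝓑) : volume B ≠ 0 :=
  ((h𝓑.isOpen B hB).measure_pos _ (h𝓑.nonempty B hB)).ne'

theorem lt_maximal_indicator (h𝓑 : IsBasis 𝓑) {B U : Set (EuclideanSpace ℝ (Fin n))} (hB : B ∈ 𝓑)
    (hU : MeasurableSet U) {θ : ℝ} (h : ENNReal.ofReal θ * volume B < volume (B ∩ U))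
    {x : EuclideanSpace ℝ (Fin n)} (hx : x ∈ B) :
    ENNReal.ofReal θ < maximal 𝓑 (U.indicator fun _ => 1) x := by
  refine lt_of_lt_of_le ?_ (le_iSup₂_of_le (f := fun B _ => ⨆ _ : x ∈ B, _) B hB
    (le_iSup_of_le hx le_rfl))
  have : ∀ y, ‖U.indicator (fun _ => (1 : ℝ)) y‖ₑ = U.indicator 1 y := fun y => by
    by_cases hy : y ∈ U <;> simp [hy]
  simp only [this]
  rw [setLAverage_eq, lintegral_indicator_one hU, Measure.restrict_apply hU,
    ENNReal.lt_div_iff_mul_lt (Or.inl (h𝓑.volume_ne_zero hB)) (Or.inl (h𝓑.volume_lt_top B hB).ne),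
    Set.inter_comm]
  exact h

/-- Under a Tauberian condition, `∫ sup_B d_B 1_B` is controlled by the sums `∑ d_A ν(A)` over
finite subfamilies with large disjoint pieces. -/
theorem lintegral_iSup_le_of_tauberian (h𝓑 : IsBasis 𝓑) {γ : ℝ} (hγ₀ : 0 < γ) (hγ₁ : γ < 1)
    {ν : Measure (EuclideanSpace ℝ (Fin n))} [SFinite ν] {C : ℝ≥0}
    (hC : ∀ E : Set (EuclideanSpace ℝ (Fin n)), MeasurableSet E →
      ν {x | ENNReal.ofReal γ < maximal 𝓑 (E.indicator fun _ => 1) x} ≤ C * ν E)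
    (d : Set (EuclideanSpace ℝ (Fin n)) → ℝ≥0∞) (D : ℝ≥0∞)
    (hD : ∀ (T : Finset (Set (EuclideanSpace ℝ (Fin n))))
      (E : Set (EuclideanSpace ℝ (Fin n)) → Set (EuclideanSpace ℝ (Fin n))), ↑T ⊆ 𝓑 →
      (∀ A ∈ T, E A ⊆ A ∧ MeasurableSet (E A) ∧
        ENNReal.ofReal (1 - γ) * volume A ≤ volume (E A)) →
      (T : Set (Set (EuclideanSpace ℝ (Fin n)))).PairwiseDisjoint E →
      ∑ A ∈ T, d A * ν A ≤ D) :
    ∫⁻ x, ⨆ B ∈ 𝓑, ⨆ _ : x ∈ B, d B ∂ν ≤ C * D := by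
  classical
  have hfinite : ∀ s : Finset (Set (EuclideanSpace ℝ (Fin n))), ↑s ⊆ 𝓑 →
      ∫⁻ x, ⨆ B ∈ s, ⨆ _ : x ∈ B, d B ∂ν ≤ C * D := by
    intro s hs
    obtain ⟨T, hTs, E, hE, hdisj, hcov⟩ := exists_greedy_selection (μ := volume) hγ₀ hγ₁ d s
      (fun B hB => (h𝓑.isOpen B (hs hB)).measurableSet) (fun B hB => h𝓑.volume_ne_zero (hs hB))
      (fun B hB => (h𝓑.volume_lt_top B (hs hB)).ne)
    have hT : (T : Set (Set (EuclideanSpace ℝ (Fin n)))) ⊆ 𝓑 := fun A hA => hs (hTs hA)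
    have hmF := (lowerSemicontinuous_iSup_mem (S := ↑s) (fun B hB => h𝓑.isOpen B (hs hB))
      d).measurable
    have hmH := (lowerSemicontinuous_iSup_mem (S := ↑T) (fun B hB => h𝓑.isOpen B (hT hB))
      d).measurable
    simp only [Finset.mem_coe] at hmF hmH
    calc ∫⁻ x, ⨆ B ∈ s, ⨆ _ : x ∈ B, d B ∂ν
        ≤ C * ∫⁻ x, ⨆ B ∈ T, ⨆ _ : x ∈ B, d B ∂ν := by
          refine lintegral_le_of_measure_lt_le hmF hmH C fun t => ?_
          have hmU := measurableSet_lt (measurable_const (a := t)) hmH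
          -- If `d B > t`, the selected sets covering more than the fraction `γ` of `B` also have
          -- value above `t`, so they lie in the superlevel set of the selected supremum.
          refine (measure_mono fun x hx => ?_).trans (hC _ hmU)
          simp only [Set.mem_ofPred_eq, lt_iSup_iff] at hx
          obtain ⟨B, hB, hxB, htB⟩ := hx
          refine lt_maximal_indicator h𝓑 (hs hB) hmU ((hcov B hB).trans_le
            (measure_mono (Set.inter_subset_inter_right _ fun y hy => ?_))) hxB
          simp only [Set.mem_iUnion] at hy
          obtain ⟨A, hA, hdA, hyA⟩ := hy
          simp only [Set.mem_ofPred_eq, lt_iSup_iff]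
          exact ⟨A, hA, hyA, htB.trans_le hdA⟩
      _ ≤ C * ∫⁻ x, ∑ A ∈ T, A.indicator (fun _ => d A) x ∂ν := by
          gcongr with x
          refine iSup₂_le fun A hA => iSup_le fun hx => ?_
          refine le_trans ?_ (Finset.single_le_sum (f := fun A => A.indicator (fun _ => d A) x)
            (fun _ _ => zero_le) hA)
          simp [hx]
      _ = C * ∑ A ∈ T, d A * ν A := by
          have hm : ∀ A ∈ T, MeasurableSet A := fun A hA => (h𝓑.isOpen A (hT hA)).measurableSet
          rw [lintegral_finsetSum _ fun A hA => measurable_const.indicator (hm A hA)]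
          congr 1
          exact Finset.sum_congr rfl fun A hA => lintegral_indicator_const (hm A hA) _
      _ ≤ C * D := by
          gcongr
          exact hD T E hT hE hdisj
  -- The finite bound is uniform, so a countable subfamily and monotone convergence give the whole
  -- basis.
  obtain ⟨S, hS𝓑, hSc, hSeq⟩ := exists_countable_iSup_mem_eq h𝓑.isOpen d
  simp only [hSeq]
  rcases S.eq_empty_or_nonempty with rfl | hne
  · simp
  obtain ⟨u, rfl⟩ := hSc.exists_eq_range hne
  have hmono : Monotone fun (N : ℕ) x =>
      ⨆ B ∈ (Finset.range N).image u, ⨆ _ : x ∈ B, d B := fun N N' h x =>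
    biSup_mono (f := fun B => ⨆ _ : x ∈ B, d B) fun B hB =>
      Finset.image_subset_image (Finset.range_mono h) hB
  have hsub : ∀ N, (((Finset.range N).image u : Finset _) : Set _) ⊆ 𝓑 := fun N B hB => by
    obtain ⟨k, -, rfl⟩ := Finset.mem_image.1 hB
    exact hS𝓑 ⟨k, rfl⟩
  calc ∫⁻ x, ⨆ B ∈ Set.range u, ⨆ _ : x ∈ B, d B ∂ν
      ≤ ∫⁻ x, ⨆ N : ℕ, ⨆ B ∈ (Finset.range N).image u, ⨆ _ : x ∈ B, d B ∂ν := by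
        refine lintegral_mono fun x => iSup₂_le fun B hB => ?_
        obtain ⟨k, rfl⟩ := hB
        exact le_iSup_of_le (k + 1) (le_iSup₂_of_le (f := fun B _ => ⨆ _ : x ∈ B, d B) (u k)
          (Finset.mem_image_of_mem _ (by simp)) le_rfl)
    _ = ⨆ N : ℕ, ∫⁻ x, ⨆ B ∈ (Finset.range N).image u, ⨆ _ : x ∈ B, d B ∂ν := by
        refine lintegral_iSup (fun N => ?_) hmono
        exact (lowerSemicontinuous_iSup_mem (S := ↑((Finset.range N).image u))
          (fun B hB => h𝓑.isOpen B (hsub N hB)) d).measurable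
    _ ≤ C * D := iSup_le fun N => hfinite _ (hsub N)

end BasisMaximal

/-! ### Function norms, dilations and weighted norms -/

namespace BasisMaximal

variable {n : ℕ}

theorem BanachFunctionSpace.lintegral_mul_le (Y : BanachFunctionSpace n)
    {f : EuclideanSpace ℝ (Fin n) → ℝ≥0∞} (g : EuclideanSpace ℝ (Fin n) → ℝ≥0∞)
    (hf : AEMeasurable f volume) (hfin : Y.norm f ≠ ∞) :
    ∫⁻ x, f x * g x ≤ Y.norm f * Y.associateNorm g := by
  rcases eq_or_ne (Y.norm f) 0 with h0 | h0
  · have : ∫⁻ x, f x * g x = ∫⁻ _, 0 :=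
      lintegral_congr_ae (((Y.norm_eq_zero_iff f hf).1 h0).mono fun x hx => by simp [hx])
    simp [this]
  · have hc : (((Y.norm f).toNNReal⁻¹ : ℝ≥0) : ℝ≥0∞) = (Y.norm f)⁻¹ := by
      rw [ENNReal.coe_inv (ENNReal.toNNReal_ne_zero.2 ⟨h0, hfin⟩), ENNReal.coe_toNNReal hfin]
    have h1 := Y.norm_smul (Y.norm f).toNNReal⁻¹ f hf
    rw [hc, ENNReal.inv_mul_cancel h0 hfin] at h1
    have h2 : ∫⁻ x, (Y.norm f)⁻¹ * f x * g x ≤ Y.associateNorm g :=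
      le_iSup₂_of_le (f := fun f (_ : AEMeasurable f volume) => ⨆ _ : Y.norm f ≤ 1,
        ∫⁻ x, f x * g x) (fun x => (Y.norm f)⁻¹ * f x) (hf.const_mul _)
        (le_iSup_of_le h1.le le_rfl)
    simp only [mul_assoc] at h2
    rw [lintegral_const_mul' _ _ (ENNReal.inv_ne_top.2 h0), mul_comm,
      ← div_eq_mul_inv, ENNReal.div_le_iff h0 hfin] at h2
    rwa [mul_comm]

/-- Since `k · 1_{f = ∞} ≤ f` for every finite `k`, homogeneity forces the norm of the indicator to
vanish. -/
theorem BanachFunctionSpace.ae_ne_top (Y : BanachFunctionSpace n)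
    {f : EuclideanSpace ℝ (Fin n) → ℝ≥0∞} (hf : Measurable f) (hfin : Y.norm f ≠ ∞) :
    ∀ᵐ x, f x ≠ ∞ := by
  set Z : Set (EuclideanSpace ℝ (Fin n)) := {x | f x = ∞}
  have hZ : MeasurableSet Z := hf (measurableSet_singleton ∞)
  have hm : AEMeasurable (Z.indicator (fun _ => (1 : ℝ≥0∞))) volume :=
    (measurable_const.indicator hZ).aemeasurable
  have hk : ∀ k : ℝ≥0, k * Y.norm (Z.indicator fun _ => 1) ≤ Y.norm f := fun k => by
    rw [← Y.norm_smul k _ hm]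
    refine Y.norm_mono _ _ (hm.const_mul _) hf.aemeasurable (ae_of_all _ fun x => ?_)
    by_cases hx : x ∈ Z
    · simp [show f x = ∞ from hx]
    · simp [hx]
  have h0 : Y.norm (Z.indicator fun _ => 1) = 0 := by
    by_contra h0
    obtain ⟨k, hk'⟩ := ENNReal.exists_nat_mul_gt h0 hfin
    exact absurd (hk k) (by simpa using hk')
  filter_upwards [(Y.norm_eq_zero_iff _ hm).1 h0] with x hx hxZ
  simp [Set.indicator_of_mem (show x ∈ Z from hxZ)] at hx

/-- The Jacobian behind `localNorm`: for `δ = |B|^{1/n}`, dilation by `δ` turns integrals into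
averages over `B`. -/
theorem abs_inv_dilation_pow (hn : 0 < n) {B : Set (EuclideanSpace ℝ (Fin n))}
    (hB₀ : volume B ≠ 0) (hB : volume B ≠ ∞) :
    (volume B).toReal ^ (1 / (n : ℝ)) ≠ 0 ∧
    ENNReal.ofReal |(((volume B).toReal ^ (1 / (n : ℝ))) ^
      Module.finrank ℝ (EuclideanSpace ℝ (Fin n)))⁻¹| = (volume B)⁻¹ := by
  have hpos := ENNReal.toReal_pos hB₀ hB
  refine ⟨(Real.rpow_pos_of_pos hpos _).ne', ?_⟩
  rw [finrank_euclideanSpace_fin, one_div, Real.rpow_inv_natCast_pow hpos.le hn.ne',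
    abs_of_pos (inv_pos.2 hpos), ENNReal.ofReal_inv_of_pos hpos, ENNReal.ofReal_toReal hB]

theorem volume_preimage_dilation (hn : 0 < n) {B : Set (EuclideanSpace ℝ (Fin n))}
    (hB₀ : volume B ≠ 0) (hB : volume B ≠ ∞) (s : Set (EuclideanSpace ℝ (Fin n))) :
    volume ((fun x => ((volume B).toReal ^ (1 / (n : ℝ))) • x) ⁻¹' s) =
      (volume B)⁻¹ * volume s := by
  obtain ⟨h0, h1⟩ := abs_inv_dilation_pow hn hB₀ hB
  rw [Measure.addHaar_preimage_smul _ h0, h1]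

theorem setLAverage_eq_lintegral_dilation (hn : 0 < n) {B : Set (EuclideanSpace ℝ (Fin n))}
    (hBm : MeasurableSet B) (hB₀ : volume B ≠ 0) (hB : volume B ≠ ∞)
    (h : EuclideanSpace ℝ (Fin n) → ℝ≥0∞) :
    ⨍⁻ y in B, h y ∂volume = ∫⁻ x, B.indicator h (((volume B).toReal ^ (1 / (n : ℝ))) • x) := by
  obtain ⟨h0, h1⟩ := abs_inv_dilation_pow hn hB₀ hB
  have hmap := Measure.map_addHaar_smul (volume : Measure (EuclideanSpace ℝ (Fin n))) h0
  have := (Homeomorph.smulOfNeZero _ h0).measurableEmbedding.lintegral_map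
    (μ := (volume : Measure (EuclideanSpace ℝ (Fin n)))) (B.indicator h)
  rw [show ⇑(Homeomorph.smulOfNeZero _ h0) = fun x : EuclideanSpace ℝ (Fin n) =>
    ((volume B).toReal ^ (1 / (n : ℝ))) • x from rfl, hmap, h1, lintegral_smul_measure,
    lintegral_indicator hBm] at this
  rw [← this, setLAverage_eq, div_eq_mul_inv, mul_comm, smul_eq_mul]

theorem measurable_indicator_dilation {B : Set (EuclideanSpace ℝ (Fin n))}
    (hBm : MeasurableSet B) {a : EuclideanSpace ℝ (Fin n) → ℝ≥0∞} (ha : Measurable a) (δ : ℝ) :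
    Measurable fun x => B.indicator a (δ • x) :=
  (ha.indicator hBm).comp (measurable_const_smul δ)

/-- Hölder's inequality for the averages `‖·‖_{Y,B}` and `‖·‖_{Y',B}`. -/
theorem BanachFunctionSpace.setLAverage_mul_le (Y : BanachFunctionSpace n) (hn : 0 < n)
    {B : Set (EuclideanSpace ℝ (Fin n))} (hBm : MeasurableSet B) (hB₀ : volume B ≠ 0)
    (hB : volume B ≠ ∞) {a : EuclideanSpace ℝ (Fin n) → ℝ≥0∞} (ha : Measurable a)
    (b : EuclideanSpace ℝ (Fin n) → ℝ≥0∞) (hfin : localNorm Y.norm B a ≠ ∞) :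
    ⨍⁻ y in B, a y * b y ∂volume ≤ localNorm Y.norm B a * localNorm Y.associateNorm B b := by
  rw [setLAverage_eq_lintegral_dilation hn hBm hB₀ hB]
  refine le_trans (lintegral_mono fun x => ?_)
    (Y.lintegral_mul_le _ (measurable_indicator_dilation hBm ha _).aemeasurable hfin)
  exact (congrFun (Set.indicator_mul B a b) _).le

theorem BanachFunctionSpace.ae_ne_top_of_localNorm (Y : BanachFunctionSpace n) (hn : 0 < n)
    {B : Set (EuclideanSpace ℝ (Fin n))} (hBm : MeasurableSet B) (hB₀ : volume B ≠ 0)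
    (hB : volume B ≠ ∞) {a : EuclideanSpace ℝ (Fin n) → ℝ≥0∞} (ha : Measurable a)
    (hfin : localNorm Y.norm B a ≠ ∞) : ∀ᵐ x ∂volume.restrict B, a x ≠ ∞ := by
  have h := Y.ae_ne_top (measurable_indicator_dilation hBm ha _) hfin
  rw [ae_restrict_iff' hBm, ae_iff]
  have h' := volume_preimage_dilation hn hB₀ hB {x | ¬(x ∈ B → a x ≠ ∞)}
  have h0 : volume ((fun x => ((volume B).toReal ^ (1 / (n : ℝ))) • x) ⁻¹'
      {x | ¬(x ∈ B → a x ≠ ∞)}) = 0 := by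
    refine measure_mono_null (fun x hx => ?_) (ae_iff.1 h)
    simp only [Set.mem_preimage, Set.mem_ofPred_eq, Classical.not_imp, not_not] at hx ⊢
    rw [Set.indicator_of_mem hx.1, hx.2]
  rw [h0, eq_comm, mul_eq_zero] at h'
  exact h'.resolve_left (ENNReal.inv_ne_zero.2 hB)

theorem BanachFunctionSpace.localNorm_ne_zero (Y : BanachFunctionSpace n) (hn : 0 < n)
    {B : Set (EuclideanSpace ℝ (Fin n))} (hBm : MeasurableSet B) (hB₀ : volume B ≠ 0)
    (hB : volume B ≠ ∞) {a : EuclideanSpace ℝ (Fin n) → ℝ≥0∞} (ha : Measurable a)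
    (hpos : ∀ x, a x ≠ 0) : localNorm Y.norm B a ≠ 0 := by
  intro h
  have h0 := (Y.norm_eq_zero_iff _ (measurable_indicator_dilation hBm ha _).aemeasurable).1 h
  have h1 := volume_preimage_dilation hn hB₀ hB B
  rw [ENNReal.inv_mul_cancel hB₀ hB] at h1
  refine one_ne_zero (h1.symm.trans (measure_mono_null (fun x hx => ?_) (ae_iff.1 h0)))
  change ¬B.indicator a (((volume B).toReal ^ (1 / (n : ℝ))) • x) = 0
  rw [Set.indicator_of_mem (show _ ∈ B from hx)]
  exact hpos _

theorem aestronglyMeasurable_mul_of_powMeasure {w : EuclideanSpace ℝ (Fin n) → ℝ≥0}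
    (hw : Measurable w) {r : ℝ} (hr : 0 ≤ r) {f : EuclideanSpace ℝ (Fin n) → ℝ}
    (hf : AEStronglyMeasurable f (powMeasure w r)) :
    AEStronglyMeasurable (fun x => f x * (w x : ℝ)) volume := by
  have hd : powMeasure w r = volume.withDensity fun x => ((w x ^ r : ℝ≥0) : ℝ≥0∞) := by
    simp only [powMeasure, ENNReal.coe_rpow_of_nonneg _ hr]
  rw [hd, aestronglyMeasurable_withDensity_iff (hw.pow_const r)] at hf
  have hm : AEStronglyMeasurable (fun x => ((w x ^ (1 - r) : ℝ≥0) : ℝ)) volume :=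
    (hw.pow_const (1 - r)).coe_nnreal_real.aestronglyMeasurable
  have hind : MeasurableSet {x | w x ≠ 0} := (hw (measurableSet_singleton 0)).compl
  -- The weighted measure does not see `{w = 0}`, but `f w` vanishes there; elsewhere `f w = w^{1-r}
  -- (w^r f)`.
  refine ((hm.mul hf).indicator hind).congr (ae_of_all _ fun x => ?_)
  by_cases hx : w x = 0
  · simp [hx]
  · rw [Set.indicator_of_mem (show x ∈ {x | w x ≠ 0} from hx)]
    simp only [Pi.mul_apply, smul_eq_mul]
    rw [← mul_assoc, ← NNReal.coe_mul, ← NNReal.rpow_add hx, sub_add_cancel, NNReal.rpow_one,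
      mul_comm]

theorem eLpNorm_mul_eq_powMeasure {w : EuclideanSpace ℝ (Fin n) → ℝ≥0}
    (hw : Measurable w) {r : ℝ} (hr : 0 < r) (f : EuclideanSpace ℝ (Fin n) → ℝ) :
    eLpNorm (fun x => f x * (w x : ℝ)) (ENNReal.ofReal r) volume =
      eLpNorm f (ENNReal.ofReal r) (powMeasure w r) := by
  have h0 : ENNReal.ofReal r ≠ 0 := by simpa using hr
  rw [eLpNorm_eq_lintegral_rpow_enorm_toReal h0 ENNReal.ofReal_ne_top,
    eLpNorm_eq_lintegral_rpow_enorm_toReal h0 ENNReal.ofReal_ne_top, ENNReal.toReal_ofReal hr.le,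
    powMeasure, lintegral_withDensity_eq_lintegral_mul_non_measurable _
      (hw.coe_nnreal_ennreal.pow_const r)
      (ae_of_all _ fun x => ENNReal.rpow_lt_top_of_nonneg hr.le ENNReal.coe_ne_top)]
  congr 1
  refine lintegral_congr fun x => ?_
  simp only [Pi.mul_apply]
  rw [enorm_mul, ENNReal.mul_rpow_of_nonneg _ _ hr.le, mul_comm]
  congr 2
  simp [enorm_eq_nnnorm]

theorem sum_rpow_le_rpow_sum {ι : Type*} (s : Finset ι) (x : ι → ℝ≥0∞) {r : ℝ} (hr : 1 ≤ r) :
    ∑ i ∈ s, x i ^ r ≤ (∑ i ∈ s, x i) ^ r := by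
  classical
  induction s using Finset.induction_on with
  | empty => simp
  | insert a s ha ih =>
    rw [Finset.sum_insert ha, Finset.sum_insert ha]
    exact (add_le_add_right ih _).trans (ENNReal.add_rpow_le_rpow_add _ _ hr)

end BasisMaximal

/-! ### The estimate on one set and the conclusion -/

namespace BasisMaximal

/-- The contribution of one set of the basis: Hölder's inequality combined with the bump
condition. -/
theorem rpow_mul_powMeasure_le {n m : ℕ} (hn : 0 < n) {p q : ℝ} (hp : 0 < p) (hq : 0 < q)
    (Y : Fin m → BanachFunctionSpace n)
    {w : Fin m → EuclideanSpace ℝ (Fin n) → ℝ≥0} (hw : ∀ i, Measurable (w i))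
    (v : EuclideanSpace ℝ (Fin n) → ℝ≥0)
    {B : Set (EuclideanSpace ℝ (Fin n))} (hBm : MeasurableSet B) (hB₀ : volume B ≠ 0)
    (hB : volume B ≠ ∞) {a K : ℝ≥0∞} (ha : a ≠ 0) (hK : K ≠ ∞)
    (hbump : a * volume B ^ (1 / q - 1 / p) *
      (⨍⁻ x in B, (v x : ℝ≥0∞) ^ q ∂volume) ^ (1 / q) *
      ∏ i, localNorm (Y i).norm B (fun x => (w i x : ℝ≥0∞)⁻¹) ≤ K)
    (f : Fin m → EuclideanSpace ℝ (Fin n) → ℝ) :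
    (a * ∏ i, ⨍⁻ y in B, ‖f i y‖ₑ ∂volume) ^ q * powMeasure v q B ≤
      K ^ q * ((∏ i, localNorm (Y i).associateNorm B fun y => ‖f i y * (w i y : ℝ)‖ₑ) ^ p *
        volume B) ^ (q / p) := by
  set A := ⨍⁻ x in B, (v x : ℝ≥0∞) ^ q ∂volume with hA
  have hν : powMeasure v q B = volume B * A := by
    rw [powMeasure, withDensity_apply _ hBm, hA, setLAverage_eq, ENNReal.mul_div_cancel hB₀ hB]
  rcases eq_or_ne A 0 with hA0 | hA0
  · simp [hν, hA0]
  have hwm : ∀ i, Measurable fun x => (w i x : ℝ≥0∞)⁻¹ := fun i => (hw i).coe_nnreal_ennreal.inv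
  have hW0 : ∀ i, localNorm (Y i).norm B (fun x => (w i x : ℝ≥0∞)⁻¹) ≠ 0 := fun i =>
    (Y i).localNorm_ne_zero hn hBm hB₀ hB (hwm i) fun x => by simp
  -- All other factors of the bump product are nonzero, so one infinite norm would make the product
  -- infinite.
  have hWtop : ∀ i, localNorm (Y i).norm B (fun x => (w i x : ℝ≥0∞)⁻¹) ≠ ∞ := by
    intro i hi
    refine hK (top_le_iff.1 (le_trans (le_of_eq ?_) hbump))
    rw [← Finset.mul_prod_erase _ _ (Finset.mem_univ i), hi,
      ENNReal.top_mul (Finset.prod_ne_zero_iff.2 fun j _ => hW0 j), ENNReal.mul_top]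
    refine mul_ne_zero (mul_ne_zero ha ?_) ?_
    · exact (ENNReal.rpow_pos (pos_iff_ne_zero.2 hB₀) hB).ne'
    · simp [ENNReal.rpow_eq_zero_iff, hA0, hq.not_gt]
  have hHolder : ∀ i, ⨍⁻ y in B, ‖f i y‖ₑ ∂volume ≤
      localNorm (Y i).norm B (fun x => (w i x : ℝ≥0∞)⁻¹) *
        localNorm (Y i).associateNorm B fun y => ‖f i y * (w i y : ℝ)‖ₑ := by
    intro i
    refine le_trans (le_of_eq (laverage_congr ?_))
      ((Y i).setLAverage_mul_le hn hBm hB₀ hB (hwm i) _ (hWtop i))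
    -- A finite norm of `wᵢ⁻¹` forces `wᵢ ≠ 0` a.e. on `B`, so `wᵢ⁻¹ wᵢ` cancels.
    filter_upwards [(Y i).ae_ne_top_of_localNorm hn hBm hB₀ hB (hwm i) (hWtop i)] with x hx
    have hx0 : (w i x : ℝ≥0∞) ≠ 0 := fun h => hx (by simp [h])
    have he : ‖(w i x : ℝ)‖ₑ = w i x := by simp [enorm_eq_nnnorm]
    rw [enorm_mul, he, mul_comm, mul_assoc, ENNReal.mul_inv_cancel hx0 ENNReal.coe_ne_top, mul_one]
  set W := ∏ i, localNorm (Y i).norm B (fun x => (w i x : ℝ≥0∞)⁻¹)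
  set G := ∏ i, localNorm (Y i).associateNorm B fun y => ‖f i y * (w i y : ℝ)‖ₑ
  have hprod : ∏ i, ⨍⁻ y in B, ‖f i y‖ₑ ∂volume ≤ W * G := by
    rw [← Finset.prod_mul_distrib]
    exact Finset.prod_le_prod' fun i _ => hHolder i
  calc (a * ∏ i, ⨍⁻ y in B, ‖f i y‖ₑ ∂volume) ^ q * powMeasure v q B
      ≤ (a * (W * G)) ^ q * (volume B * A) := by
        rw [hν]
        gcongr
    _ = (a * volume B ^ (1 / q - 1 / p) * A ^ (1 / q) * W) ^ q *
          (G ^ p * volume B) ^ (q / p) := by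
        have hV : volume B = (volume B ^ (1 / q - 1 / p)) ^ q * volume B ^ (q / p) := by
          rw [← ENNReal.rpow_mul, ← ENNReal.rpow_add _ _ hB₀ hB]
          conv_lhs => rw [← ENNReal.rpow_one (volume B)]
          congr 1
          field_simp
          ring
        have hA' : A = (A ^ (1 / q)) ^ q := by
          rw [← ENNReal.rpow_mul, one_div_mul_cancel hq.ne', ENNReal.rpow_one]
        have hG : G ^ q = (G ^ p) ^ (q / p) := by
          rw [← ENNReal.rpow_mul, mul_div_cancel₀ _ hp.ne']
        conv_lhs => rw [hV, hA']
        simp only [ENNReal.mul_rpow_of_nonneg _ _ hq.le,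
          ENNReal.mul_rpow_of_nonneg _ _ (div_pos hq hp).le, hG]
        ring
    _ ≤ K ^ q * (G ^ p * volume B) ^ (q / p) := by gcongr

end BasisMaximal

open BasisMaximal in
theorem theorem2p8 {n m : ℕ} (hn : 0 < n)
    (P : Fin m → ℝ) (hP : ∀ i, 1 < P i) (p q : ℝ) (hp : 0 < p) (hpP : 1 / p = ∑ i, 1 / P i)
    (hpq : p ≤ q)
    (φ : ℝ → ℝ) (hφpos : ∀ t, 0 < t → 0 < φ t)
    (hφmono : ∃ c : ℝ, ∀ s t, 0 < s → s ≤ t → φ s ≤ c * φ t)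
    (hφlim : Tendsto (fun t => φ t / t) atTop (𝓝 0))
    (𝓑 : Set (Set (EuclideanSpace ℝ (Fin n)))) (h𝓑 : BasisMaximal.IsBasis 𝓑)
    (Y : Fin m → BasisMaximal.BanachFunctionSpace n)
    (hY : BasisMaximal.BoundedOn (BasisMaximal.associateMaximal 𝓑 Y) P (fun _ => volume) p volume)
    (w : Fin m → EuclideanSpace ℝ (Fin n) → ℝ≥0) (hw : ∀ i, Measurable (w i))
    (v : EuclideanSpace ℝ (Fin n) → ℝ≥0) (hv : Measurable v)
    (γ : ℝ) (hγ₀ : 0 < γ) (hγ₁ : γ < 1)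
    (hA : BasisMaximal.Tauberian 𝓑 γ (BasisMaximal.powMeasure v q))
    (hvw : (⨆ B ∈ 𝓑,
        ENNReal.ofReal (φ (volume B).toReal) * volume B ^ (1 / q - 1 / p) *
          (⨍⁻ x in B, (v x : ℝ≥0∞) ^ q ∂volume) ^ (1 / q) *
          ∏ i, BasisMaximal.localNorm (Y i).norm B (fun x => (w i x : ℝ≥0∞)⁻¹)) < ∞) :
    BasisMaximal.BoundedOn (BasisMaximal.fractionalMaximal 𝓑 φ) P
      (fun i => BasisMaximal.powMeasure (w i) (P i)) q (BasisMaximal.powMeasure v q) := by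

  have hq : 0 < q := hp.trans_le hpq
  obtain ⟨C₀, hC₀⟩ := hA
  obtain ⟨C₁, hC₁⟩ := hY
  set K := ⨆ B ∈ 𝓑, ENNReal.ofReal (φ (volume B).toReal) * volume B ^ (1 / q - 1 / p) *
    (⨍⁻ x in B, (v x : ℝ≥0∞) ^ q ∂volume) ^ (1 / q) *
    ∏ i, localNorm (Y i).norm B (fun x => (w i x : ℝ≥0∞)⁻¹)
  set θ := ENNReal.ofReal (1 - γ)
  have hθ0 : θ ≠ 0 := by simpa [θ] using hγ₁
  have hθtop : θ ≠ ∞ := ENNReal.ofReal_ne_top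
  have : SFinite (powMeasure v q) := by unfold powMeasure; infer_instance
  -- The factors come from the Tauberian condition, the bump condition, the size of the disjoint
  -- pieces and the bound for the associate maximal operator.
  have hCtop : (C₀ : ℝ≥0∞) ^ (1 / q) * K * θ⁻¹ ^ (1 / p) * C₁ ≠ ∞ := by
    refine ENNReal.mul_ne_top (ENNReal.mul_ne_top (ENNReal.mul_ne_top ?_ hvw.ne) ?_)
      ENNReal.coe_ne_top
    · exact ENNReal.rpow_ne_top_of_nonneg (by positivity) ENNReal.coe_ne_top
    · exact ENNReal.rpow_ne_top_of_nonneg (by positivity) (ENNReal.inv_ne_top.2 hθ0)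
  refine ⟨((C₀ : ℝ≥0∞) ^ (1 / q) * K * θ⁻¹ ^ (1 / p) * C₁).toNNReal, fun f hf => ?_⟩
  rw [ENNReal.coe_toNNReal hCtop]
  have hP0 : ∀ i, 0 < P i := fun i => zero_lt_one.trans (hP i)
  have hLp : ∀ i, MemLp (fun x => f i x * (w i x : ℝ)) (ENNReal.ofReal (P i)) volume := fun i =>
    ⟨aestronglyMeasurable_mul_of_powMeasure (hw i) (hP0 i).le (hf i).1, by
      rw [eLpNorm_mul_eq_powMeasure (hw i) (hP0 i)]; exact (hf i).2⟩
  set N := ∏ i, eLpNorm (f i) (ENNReal.ofReal (P i)) (powMeasure (w i) (P i))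
  set M := associateMaximal 𝓑 Y fun i x => f i x * (w i x : ℝ)
  have hp0 : ENNReal.ofReal p ≠ 0 := by simpa using hp
  have hq0 : ENNReal.ofReal q ≠ 0 := by simpa using hq
  have hMp : ∫⁻ x, M x ^ p ≤ (C₁ * N) ^ p := by
    have h := (hC₁ _ hLp).2
    simp only [eLpNorm_mul_eq_powMeasure (hw _) (hP0 _)] at h
    rw [eLpNorm_eq_lintegral_rpow_enorm_toReal hp0 ENNReal.ofReal_ne_top,
      ENNReal.toReal_ofReal hp.le] at h
    simp only [enorm_eq_self] at h
    have h' := ENNReal.rpow_le_rpow h hp.le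
    rwa [← ENNReal.rpow_mul, one_div_mul_cancel hp.ne', ENNReal.rpow_one] at h'
  have hNtop : N ≠ ∞ := ENNReal.prod_ne_top fun i _ => (hf i).2.ne
  have hint : ∫⁻ x, fractionalMaximal 𝓑 φ f x ^ q ∂powMeasure v q ≤
      C₀ * (K ^ q * (θ⁻¹ * (C₁ * N) ^ p) ^ (q / p)) := by
    have hpow : ∀ x, fractionalMaximal 𝓑 φ f x ^ q = ⨆ B ∈ 𝓑, ⨆ _ : x ∈ B,
        (ENNReal.ofReal (φ (volume B).toReal) * ∏ i, ⨍⁻ y in B, ‖f i y‖ₑ ∂volume) ^ q := by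
      intro x
      -- The `q`-th power is an order isomorphism, so it passes inside the suprema.
      change ENNReal.orderIsoRpow q hq (fractionalMaximal 𝓑 φ f x) = _
      simp only [fractionalMaximal, OrderIso.map_iSup, ENNReal.orderIsoRpow_apply]
    simp only [hpow]
    refine lintegral_iSup_le_of_tauberian h𝓑 hγ₀ hγ₁ hC₀ _ _ fun T E hT hE hdisj => ?_
    set G : Set (EuclideanSpace ℝ (Fin n)) → ℝ≥0∞ := fun B =>
      ∏ i, localNorm (Y i).associateNorm B fun y => ‖f i y * (w i y : ℝ)‖ₑ
    have hvol : ∀ A ∈ T, G A ^ p * volume A ≤ θ⁻¹ * ∫⁻ x in E A, M x ^ p := by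
      intro A hAT
      obtain ⟨hEA, hEm, hEv⟩ := hE A hAT
      calc G A ^ p * volume A = θ⁻¹ * (G A ^ p * (θ * volume A)) := by
            rw [mul_left_comm (G A ^ p), ← mul_assoc, ENNReal.inv_mul_cancel hθ0 hθtop, one_mul]
        _ ≤ θ⁻¹ * (G A ^ p * volume (E A)) := by gcongr
        _ = θ⁻¹ * ∫⁻ _ in E A, G A ^ p := by rw [setLIntegral_const]
        _ ≤ θ⁻¹ * ∫⁻ x in E A, M x ^ p := by
            refine mul_le_mul_right (setLIntegral_mono' hEm fun x hx =>
              ENNReal.rpow_le_rpow ?_ hp.le) _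
            exact le_iSup₂_of_le (f := fun B _ => ⨆ _ : x ∈ B, G B) A (hT hAT)
              (le_iSup_of_le (hEA hx) le_rfl)
    calc _ ≤ ∑ A ∈ T, K ^ q * (G A ^ p * volume A) ^ (q / p) := by
          refine Finset.sum_le_sum fun A hAT => ?_
          have hA𝓑 := hT hAT
          have hvA := h𝓑.volume_ne_zero hA𝓑
          have hvA' := (h𝓑.volume_lt_top A hA𝓑).ne
          refine rpow_mul_powMeasure_le hn hp hq Y hw v (h𝓑.isOpen A hA𝓑).measurableSet
            hvA hvA' ?_ hvw.ne ?_ f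
          · simpa using hφpos _ (ENNReal.toReal_pos hvA hvA')
          · exact le_iSup₂ (f := fun B (_ : B ∈ 𝓑) => ENNReal.ofReal (φ (volume B).toReal) *
              volume B ^ (1 / q - 1 / p) * (⨍⁻ x in B, (v x : ℝ≥0∞) ^ q ∂volume) ^ (1 / q) *
              ∏ i, localNorm (Y i).norm B (fun x => (w i x : ℝ≥0∞)⁻¹)) A hA𝓑
      _ ≤ K ^ q * (∑ A ∈ T, G A ^ p * volume A) ^ (q / p) := by
          rw [← Finset.mul_sum]
          gcongr
          exact sum_rpow_le_rpow_sum _ _ ((one_le_div hp).2 hpq)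
      _ ≤ K ^ q * (θ⁻¹ * (C₁ * N) ^ p) ^ (q / p) := by
          gcongr
          calc ∑ A ∈ T, G A ^ p * volume A ≤ ∑ A ∈ T, θ⁻¹ * ∫⁻ x in E A, M x ^ p :=
                Finset.sum_le_sum hvol
            _ = θ⁻¹ * ∫⁻ x in ⋃ A ∈ T, E A, M x ^ p := by
                rw [← Finset.mul_sum, lintegral_biUnion_finset hdisj fun A hA => (hE A hA).2.1]
            _ ≤ θ⁻¹ * (C₁ * N) ^ p := by
                gcongr
                exact (setLIntegral_le_lintegral _ _).trans hMp
  have hle : eLpNorm (fractionalMaximal 𝓑 φ f) (ENNReal.ofReal q) (powMeasure v q) ≤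
      (C₀ : ℝ≥0∞) ^ (1 / q) * K * θ⁻¹ ^ (1 / p) * C₁ * N := by
    rw [eLpNorm_eq_lintegral_rpow_enorm_toReal hq0 ENNReal.ofReal_ne_top,
      ENNReal.toReal_ofReal hq.le]
    simp only [enorm_eq_self]
    refine (ENNReal.rpow_le_rpow hint (one_div_pos.2 hq).le).trans (le_of_eq ?_)
    rw [ENNReal.mul_rpow_of_nonneg _ _ (one_div_pos.2 hq).le,
      ENNReal.mul_rpow_of_nonneg _ _ (one_div_pos.2 hq).le, ← ENNReal.rpow_mul, ← ENNReal.rpow_mul,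
      mul_one_div_cancel hq.ne', ENNReal.rpow_one, div_mul_div_comm, mul_one, mul_comm p q,
      ← div_div, div_self hq.ne', ENNReal.mul_rpow_of_nonneg _ _ (one_div_pos.2 hp).le,
      ← ENNReal.rpow_mul, mul_one_div_cancel hp.ne', ENNReal.rpow_one]
    ring
  refine ⟨⟨?_, hle.trans_lt (ENNReal.mul_lt_top hCtop.lt_top hNtop.lt_top)⟩, hle⟩
  exact (lowerSemicontinuous_iSup_mem h𝓑.isOpen fun B =>
    ENNReal.ofReal (φ (volume B).toReal) *
      ∏ i, ⨍⁻ y in B, ‖f i y‖ₑ ∂volume).measurable.aestronglyMeasurable
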